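/- Let $n\ge 1$ and let $U\subset\mathbb R^n$ be a bounded domain whose boundary $S$ is smooth (near each of its points $S$ is a smooth hypersurface with $U$ on one side). Let $m$ be an even positive integer, let $A=\sum_{|\alpha|\le m}a_\alpha(x)\,\partial^\alpha$ be a real linear differential operator with coefficients continuous on $\overline U$ that is elliptic of order $m$ in $U$, i.e. $\sum_{|\alpha|=m}a_\alpha(x)\xi^\alpha\neq0$ for all $x\in U$ and $0\ne\xi\in\mathbb R^n$, and let $B_j=\sum_{|\beta|\le m_j}b_{j\beta}(x)\,\partial^\beta$, $j=1,\dots,\frac m2$, be real boundary operators with coefficients continuous on $S$, such that $m_j<m$, $m_j\neq m_k$ for $j\ne k$, and the normal is nowhere characteristic: $\sum_{|\beta|=m_j}b_{j\beta}(x)\nu(x)^\beta\neq0$ for every $x\in S$, where $\nu(x)$ is normal to $S$ at $x$. All function spaces are real. Put $$\mathcal D(A)=\{u\in H^m(U): B_ju=0 \text{ on } S,\ j=1,\dots,\tfrac m2\},$$ where $B_ju$ on $S$ is understood by continuous extension from functions smooth up to the boundary, as an operator $H^m(U)\to L^2(S)$. Assume that $(U,A,B_1,\dots,B_{m/2})$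 is admissible: in addition to the above, $A$ maps $\mathcal D(A)$ one-to-one onto $L^2(U)$, and $A^{-1}$ is self-adjoint in $L^2(U)$. Assume that $A$ is positive, i.e. every (complex) eigenvalue of $A$ on $\mathcal D(A)$ is real and positive, and that $m>n/2$. Then the Green's function exists, that is, there is a function $G\in L^2(U\times U)$ with $$(A^{-1}f)(x)=\int_U G(x,\xi)f(\xi)\,d\xi\quad\text{for a.e. }x\in U,\ \text{for every } f\in L^2(U),$$ and for every such $G$ and every real-valued $z\in L^2(U)$ the function $z(x)G(x,\xi)z(\xi)$ is integrable on $U\times U$ and $$\int_U\int_U z(x)\,G(x,\xi)\,z(\xi)\,d\xi\,dx\ \ge\ 0 .$$ -/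

import Mathlib

open MeasureTheory Filter Topology
open scoped ContDiff ENNReal

noncomputable section

namespace GreenPositivity

/-- Euclidean `n`-space. -/
abbrev E (n : ℕ) : Type := EuclideanSpace ℝ (Fin n)

/-- The real Hilbert space `L²(U)` (Lebesgue measure on `U`). -/
abbrev L2 {n : ℕ} (U : Set (E n)) : Type := Lp ℝ 2 (volume.restrict U)

/-- The classical partial derivative `∂_{I 0} ∂_{I 1} ⋯ ∂_{I (k-1)} φ` of order `k`,
for a tuple `I` of coordinate indices. -/
def partialDeriv {n k : ℕ} (I : Fin k → Fin n) (φ : E n → ℝ) (x : E n) : ℝ :=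
  iteratedFDeriv ℝ k φ x (fun i => EuclideanSpace.single (I i) (1 : ℝ))

/-- `g ∈ L²(U)` is the weak derivative `∂_I u` of `u ∈ L²(U)` in `U`. -/
def HasWeakDeriv {n k : ℕ} (U : Set (E n)) (I : Fin k → Fin n) (u g : L2 U) : Prop :=
  ∀ φ : E n → ℝ, ContDiff ℝ ∞ φ → HasCompactSupport φ → tsupport φ ⊆ U →
    ∫ x in U, u x * partialDeriv I φ x = (-1) ^ k * ∫ x in U, g x * φ x

/-- Weak derivatives are unique, so that `weakDeriv` below is well defined. -/
theorem HasWeakDeriv.unique {n k : ℕ} {U : Set (E n)} (hU : IsOpen U) {I : Fin k → Fin n}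
    {u g g' : L2 U} (h : HasWeakDeriv U I u g) (h' : HasWeakDeriv U I u g') : g = g' := by
  have hint : ∀ (w : L2 U) (φ : E n → ℝ), ContDiff ℝ ∞ φ → HasCompactSupport φ →
      IntegrableOn (fun x => w x * φ x) U := by
    intro w φ hφ hc
    have h1 : MemLp φ 2 (volume.restrict U) :=
      (hφ.continuous.memLp_of_hasCompactSupport hc).restrict U
    exact (Lp.memLp w).integrable_mul h1
  have key : ∀ᵐ x ∂volume, x ∈ U → g x - g' x = 0 := by
    refine hU.ae_eq_zero_of_integral_contDiff_smul_eq_zero (f := fun x => g x - g' x) ?_ ?_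
    · exact locallyIntegrableOn_of_locallyIntegrable_restrict
        (((Lp.memLp g).sub (Lp.memLp g')).locallyIntegrable (by norm_num))
    · intro φ hφ hc hs
      have e := (h φ hφ hc hs).symm.trans (h' φ hφ hc hs)
      have e2 : ∫ x in U, g x * φ x = ∫ x in U, g' x * φ x :=
        mul_left_cancel₀ (pow_ne_zero k (by norm_num : (-1 : ℝ) ≠ 0)) e
      have e3 : ∫ x in U, φ x • (g x - g' x) = 0 := by
        have : (fun x => φ x • (g x - g' x)) = fun x => g x * φ x - g' x * φ x := by
          funext x; simp only [smul_eq_mul]; ring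
        rw [this, integral_sub (hint g φ hφ hc) (hint g' φ hφ hc), e2, sub_self]
      rw [← setIntegral_eq_integral_of_forall_compl_eq_zero (s := U), e3]
      intro x hx
      rw [image_eq_zero_of_notMem_tsupport (fun hx' => hx (hs hx')), zero_smul]
  apply Lp.ext
  rw [EventuallyEq, ae_restrict_iff' hU.measurableSet]
  filter_upwards [key] with x hx hxU
  exact sub_eq_zero.1 (hx hxU)

/-- The Sobolev space `H^m(U)`: all weak derivatives of order at most `m` exist in `L²(U)`. -/
def sobolev {n : ℕ} (U : Set (E n)) (m : ℕ) : Set (L2 U) :=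
  {u | ∀ k ≤ m, ∀ I : Fin k → Fin n, ∃ g : L2 U, HasWeakDeriv U I u g}

open Classical in
/-- The weak derivative `∂_I u ∈ L²(U)` (`0` if there is none). -/
def weakDeriv {n k : ℕ} (U : Set (E n)) (I : Fin k → Fin n) (u : L2 U) : L2 U :=
  if h : ∃ g : L2 U, HasWeakDeriv U I u g then h.choose else 0

/-- Coefficients of a linear partial differential operator: `c k I x` is the coefficient at the
point `x` of the derivative `∂_{I 0} ⋯ ∂_{I (k-1)}` of order `k`. -/
abbrev Coeffs (n : ℕ) : Type := (k : ℕ) → (Fin k → Fin n) → E n → ℝ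

/-- The operator of order `r` with coefficients `c`, applied to a smooth function:
`∑_{k ≤ r} ∑_{I} c_I(x) ∂_I φ(x)`. -/
def Coeffs.classicalApply {n : ℕ} (c : Coeffs n) (r : ℕ) (φ : E n → ℝ) (x : E n) : ℝ :=
  ∑ k ∈ Finset.range (r + 1), ∑ I : Fin k → Fin n, c k I x * partialDeriv I φ x

/-- The operator of order `r` with coefficients `c`, applied to a Sobolev function `u` on `U`:
`∑_{k ≤ r} ∑_{I} c_I(x) ∂_I u(x)` with weak derivatives. -/
def Coeffs.weakApply {n : ℕ} (c : Coeffs n) (r : ℕ) (U : Set (E n)) (u : L2 U) (x : E n) : ℝ :=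
  ∑ k ∈ Finset.range (r + 1), ∑ I : Fin k → Fin n, c k I x * weakDeriv U I u x

/-- The principal symbol (up to the usual factor `i^r`) of the operator of order `r` with
coefficients `c`, at the point `x` and the covector `ξ`. -/
def Coeffs.symbol {n : ℕ} (c : Coeffs n) (r : ℕ) (x ξ : E n) : ℝ :=
  ∑ I : Fin r → Fin n, c r I x * ∏ i, ξ (I i)

/-- `φ` is a smooth function with nonzero gradient at `x` such that, near `x`,
`U = {φ > 0}`. -/
def IsLocalDefiningFunction {n : ℕ} (U : Set (E n)) (x : E n) (φ : E n → ℝ) : Prop :=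
  ContDiff ℝ ∞ φ ∧ gradient φ x ≠ 0 ∧ ∀ᶠ y in 𝓝 x, (y ∈ U ↔ 0 < φ y)

/-- `U` is a bounded domain in `ℝⁿ` whose boundary is smooth: near each of its points it is
a smooth hypersurface with `U` on one side of it. (By compactness the boundary is then a finite
union of disjoint smooth closed hypersurfaces.) -/
structure IsSmoothBoundedDomain {n : ℕ} (U : Set (E n)) : Prop where
  isOpen : IsOpen U
  isConnected : IsConnected U
  isBounded : Bornology.IsBounded U
  smooth_frontier : ∀ x ∈ frontier U, ∃ φ : E n → ℝ, IsLocalDefiningFunction U x φ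

/-- `ν` is a (nonzero, not necessarily unit) normal vector to the boundary of `U` at `x`. -/
def IsNormalVector {n : ℕ} (U : Set (E n)) (x ν : E n) : Prop :=
  ∃ φ : E n → ℝ, IsLocalDefiningFunction U x φ ∧ ν = gradient φ x

/-- Surface measure on the boundary of `U` (up to a constant factor, which is irrelevant here). -/
def surfaceMeasure {n : ℕ} (U : Set (E n)) : Measure (E n) :=
  (Measure.hausdorffMeasure ((n : ℝ) - 1)).restrict (frontier U)

/-- The boundary condition `B u = 0` on the boundary of `U`, for `u ∈ H^m(U)` and a boundary
operator `B` of order `r < m` with coefficients `b`. As usual, `B u` on the boundary is understood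
as the extension by continuity of `φ ↦ (B φ)|_{∂U}` from functions that are smooth up to the
boundary, as an operator from `H^m(U)` to `L²(∂U)`: there are smooth `φ_i` that converge to `u`
in `H^m(U)` and whose boundary values `B φ_i` converge to `0` in `L²(∂U)`. -/
def BoundaryCondition {n : ℕ} (U : Set (E n)) (m : ℕ) (b : Coeffs n) (r : ℕ) (u : L2 U) : Prop :=
  ∃ φ : ℕ → E n → ℝ, (∀ i, ContDiff ℝ ∞ (φ i)) ∧
    (∀ k ≤ m, ∀ I : Fin k → Fin n,
      Tendsto (fun i => eLpNorm (fun x => partialDeriv I (φ i) x - weakDeriv U I u x) 2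
        (volume.restrict U)) atTop (𝓝 0)) ∧
    Tendsto (fun i => eLpNorm (b.classicalApply r (φ i)) 2 (surfaceMeasure U)) atTop (𝓝 0)

/-- An ordered collection `(U, A, B_1, …, B_{m/2})`: a set `U`, an operator `A` of order `m` with
coefficients `a`, and boundary operators `B_j` of orders `r j` with coefficients `b j`. -/
structure Collection (n : ℕ) where
  U : Set (E n)
  m : ℕ
  a : Coeffs n
  r : Fin (m / 2) → ℕ
  b : Fin (m / 2) → Coeffs n

namespace Collection

variable {n : ℕ}

/-- The function `A u`, for `u ∈ H^m(U)`. -/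
def A (P : Collection n) (u : L2 P.U) : E n → ℝ := P.a.weakApply P.m P.U u

/-- The domain `𝓓(A) = {u ∈ H^m(U) : B_j u = 0 on ∂U, j = 1, …, m/2}`. -/
def domain (P : Collection n) : Set (L2 P.U) :=
  {u | u ∈ sobolev P.U P.m ∧ ∀ j, BoundaryCondition P.U P.m (P.b j) (P.r j) u}

/-- `u = A⁻¹ f`, that is, `u ∈ 𝓓(A)` and `A u = f` in `L²(U)`. -/
def IsSolution (P : Collection n) (f u : L2 P.U) : Prop :=
  u ∈ P.domain ∧ P.A u =ᵐ[volume.restrict P.U] f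

/-- Admissible ordered collections. -/
structure IsAdmissible (P : Collection n) : Prop where
  domain_U : IsSmoothBoundedDomain P.U
  even_m : Even P.m
  /-- The coefficients of `A` are continuous up to the boundary. -/
  continuous_a : ∀ k ≤ P.m, ∀ I : Fin k → Fin n, ContinuousOn (P.a k I) (closure P.U)
  /-- `A` is elliptic of order `m`. -/
  elliptic : ∀ x ∈ P.U, ∀ ξ : E n, ξ ≠ 0 → P.a.symbol P.m x ξ ≠ 0
  /-- The coefficients of the boundary operators are continuous. -/
  continuous_b : ∀ j, ∀ k ≤ P.r j, ∀ I : Fin k → Fin n,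
    ContinuousOn (P.b j k I) (frontier P.U)
  /-- The normal is nowhere characteristic for `B_j`. -/
  noncharacteristic : ∀ j, ∀ x ∈ frontier P.U, ∀ ν : E n, IsNormalVector P.U x ν →
    (P.b j).symbol (P.r j) x ν ≠ 0
  order_lt : ∀ j, P.r j < P.m
  order_injective : Function.Injective P.r
  /-- `A` is a one-to-one mapping from `𝓓(A)` onto `L²(U)`. -/
  bijective : ∀ f : L2 P.U, ∃! u : L2 P.U, P.IsSolution f u
  /-- The inverse of `A` is a self-adjoint operator on `L²(U)`. -/
  selfAdjoint : ∃ G : L2 P.U →L[ℝ] L2 P.U, (∀ f, P.IsSolution f (G f)) ∧ IsSelfAdjoint G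

/-- `μ` is a complex eigenvalue of `A`: there is a nonzero `w = u + i v`, with `u`, `v` in
`𝓓(A)`, such that `A w = μ w`. -/
def IsEigenvalue (P : Collection n) (μ : ℂ) : Prop :=
  ∃ u v : L2 P.U, (u ≠ 0 ∨ v ≠ 0) ∧
    P.IsSolution (μ.re • u - μ.im • v) u ∧ P.IsSolution (μ.im • u + μ.re • v) v

/-- `A` is positive: all its eigenvalues are real and positive. -/
def IsPositive (P : Collection n) : Prop :=
  ∀ μ : ℂ, P.IsEigenvalue μ → μ.im = 0 ∧ 0 < μ.re

/-- `K` is the Green's function: a square integrable kernel on `U × U` that represents the inverse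
of `A`, so `(A⁻¹ f)(x) = ∫_U K(x, ξ) f(ξ) dξ` for almost all `x`, for every `f ∈ L²(U)`. -/
def IsGreensFunction (P : Collection n) (K : E n → E n → ℝ) : Prop :=
  MemLp (Function.uncurry K) 2 ((volume.restrict P.U).prod (volume.restrict P.U)) ∧
    ∀ f u : L2 P.U, P.IsSolution f u →
      u =ᵐ[volume.restrict P.U] fun x => ∫ ξ in P.U, K x ξ * f ξ

end Collection

end GreenPositivity

end

/-! Write `G` for the inverse of `A`. Its values lie in the domain of `A`, so they are `H^m`-limits
of smooth functions. Since `m > n/2`, the Sobolev inequality makes them bounded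
(`BoundaryCondition.memLp_top`). It is proved by averaging Taylor's formula over a cone with its
vertex at the given point; a smooth boundary supplies cones of uniform shape by compactness.

By the closed graph theorem `G` is then bounded from `L²` to `L^∞`, and on a set of finite measure
such an operator is Hilbert-Schmidt: for orthonormal `e i`, the sum of `|G (e i) x|²` is at most
`C²` for almost every `x`. Hence `G` is compact and the series of the `G (b i) ⊗ b i` over a Hilbert
basis is a square integrable kernel (`exists_kernel_of_memLp_top`).

A nonzero eigenvalue of `G` is the reciprocal of an eigenvalue of `A`, hence positive. The spectral
theorem for compact self-adjoint operators gives `⟨G z, z⟩ ≥ 0`, and this inner product is the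
double integral for any kernel representing `G`. -/

namespace GreenPositivity

/-! ### Taylor's formula on `[0, 1]` -/

section Taylor

/-- The sum is the Taylor polynomial centred at `s`, evaluated at `0`. Differentiating in the centre
telescopes and leaves only the top term. -/
theorem hasDerivAt_taylor_sum {g : ℕ → ℝ → ℝ} (hg : ∀ k t, HasDerivAt (g k) (g (k + 1) t) t)
    (m : ℕ) (t : ℝ) :
    HasDerivAt (fun s => ∑ k ∈ Finset.range (m + 1), (-s) ^ k / k.factorial * g k s)
      ((-t) ^ m / m.factorial * g (m + 1) t) t := by
  induction m with
  | zero => simpa using hg 0 t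
  | succ m ih =>
    have h1 : HasDerivAt (fun s : ℝ => (-s) ^ (m + 1) / ((m + 1).factorial : ℝ))
        (-((-t) ^ m / m.factorial)) t := by
      have := ((hasDerivAt_neg t).fun_pow (m + 1)).div_const ((m + 1).factorial : ℝ)
      refine this.congr_deriv ?_
      rw [Nat.factorial_succ]
      push_cast
      field_simp
    simp_rw [Finset.sum_range_succ _ (m + 1)]
    refine (ih.add (h1.mul (hg (m + 1) t))).congr_deriv ?_
    ring

/-- A bound for `g 0 0` by the Taylor expansion at `1` with integral remainder. -/
theorem enorm_le_taylor {g : ℕ → ℝ → ℝ} (hg : ∀ k t, HasDerivAt (g k) (g (k + 1) t) t) (m : ℕ) :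
    ‖g 0 0‖ₑ ≤ ∑ k ∈ Finset.range (m + 1), ‖g k 1‖ₑ +
      ∫⁻ t in Set.Ioc (0 : ℝ) 1, ENNReal.ofReal (t ^ m) * ‖g (m + 1) t‖ₑ := by
  have hc : ∀ k, Continuous (g k) := fun k =>
    continuous_iff_continuousAt.2 fun t => (hg k t).continuousAt
  have hI : IntervalIntegrable (fun t => (-t) ^ m / m.factorial * g (m + 1) t) volume 0 1 := by
    have := hc (m + 1)
    exact Continuous.intervalIntegrable (by fun_prop) _ _
  have hF := intervalIntegral.integral_eq_sub_of_hasDerivAt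
    (fun t _ => hasDerivAt_taylor_sum hg m t) hI
  have h0 : ∑ k ∈ Finset.range (m + 1), (-(0 : ℝ)) ^ k / k.factorial * g k 0 = g 0 0 := by
    rw [Finset.sum_eq_single 0] <;> simp +contextual
  have hfac : ∀ k : ℕ, ∀ s : ℝ, ‖(-s) ^ k / (k.factorial : ℝ)‖ ≤ |s| ^ k := by
    intro k s
    rw [norm_div, norm_pow, norm_neg, Real.norm_eq_abs, Real.norm_natCast]
    exact div_le_self (by positivity) (by exact_mod_cast k.factorial_pos)
  have hg0 : g 0 0 = (∑ k ∈ Finset.range (m + 1), (-(1 : ℝ)) ^ k / k.factorial * g k 1) -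
      ∫ t in (0 : ℝ)..1, (-t) ^ m / m.factorial * g (m + 1) t := by
    rw [hF, h0]; ring
  rw [hg0]
  refine (enorm_sub_le).trans (add_le_add ?_ ?_)
  · refine (enorm_sum_le _ _).trans (Finset.sum_le_sum fun k _ => ?_)
    rw [enorm_mul]
    refine mul_le_of_le_one_left' ?_
    rw [← ofReal_norm]
    exact ENNReal.ofReal_le_one.2 (by simpa using hfac k 1)
  · rw [intervalIntegral.integral_of_le zero_le_one]
    refine (enorm_integral_le_lintegral_enorm _).trans ?_
    -- Only the factorial is discarded. The weight `t ^ m` is kept because it later compensates a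
    -- factor `t ^ (-n/2)`.
    refine setLIntegral_mono' measurableSet_Ioc fun t ht => ?_
    rw [enorm_mul]
    gcongr
    rw [← ofReal_norm]
    refine ENNReal.ofReal_le_ofReal ((hfac m t).trans ?_)
    rw [abs_of_pos ht.1]

end Taylor

/-! ### Derivatives along lines -/

section Derivatives

variable {n : ℕ}

/-- The sum of the absolute values of all partial derivatives of order `k`. -/
noncomputable def sumAbsDeriv (k : ℕ) (φ : E n → ℝ) (x : E n) : ℝ :=
  ∑ I : Fin k → Fin n, |partialDeriv I φ x|

theorem continuous_partialDeriv {φ : E n → ℝ} (hφ : ContDiff ℝ ∞ φ) {k : ℕ}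
    (I : Fin k → Fin n) : Continuous (partialDeriv I φ) := by
  have := hφ.continuous_iteratedFDeriv (m := k) (by exact_mod_cast le_top)
  unfold partialDeriv
  exact (ContinuousMultilinearMap.apply ℝ (fun _ : Fin k => E n) ℝ _).continuous.comp this

theorem continuous_sumAbsDeriv {φ : E n → ℝ} (hφ : ContDiff ℝ ∞ φ) (k : ℕ) :
    Continuous (sumAbsDeriv k φ) := by
  unfold sumAbsDeriv
  exact continuous_finsetSum _ fun I _ => (continuous_partialDeriv hφ I).abs

/-- Expand `w` in the standard basis by multilinearity; every coordinate of `w` is at most `1` in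
absolute value. -/
theorem abs_iteratedFDeriv_le_sumAbsDeriv (φ : E n → ℝ) (k : ℕ) (y : E n) {w : E n}
    (hw : ‖w‖ ≤ 1) : |iteratedFDeriv ℝ k φ y fun _ => w| ≤ sumAbsDeriv k φ y := by
  have hw' : w = ∑ j, w j • EuclideanSpace.single j (1 : ℝ) := by
    ext i
    simp [Finset.sum_apply, Pi.single_apply]
  have h1 : (iteratedFDeriv ℝ k φ y fun _ => w) =
      ∑ I : Fin k → Fin n, (∏ i, w (I i)) * partialDeriv I φ y := by
    conv_lhs => rw [hw']
    have := (iteratedFDeriv ℝ k φ y).toMultilinearMap.map_sum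
      (fun _ j => w j • EuclideanSpace.single j (1 : ℝ))
    refine this.trans (Finset.sum_congr rfl fun I _ => ?_)
    exact (iteratedFDeriv ℝ k φ y).map_smul_univ (fun i => w (I i))
      (fun i => EuclideanSpace.single (I i) (1 : ℝ))
  rw [h1]
  refine (Finset.abs_sum_le_sum_abs _ _).trans (Finset.sum_le_sum fun I _ => ?_)
  rw [abs_mul, Finset.abs_prod]
  refine mul_le_of_le_one_left (abs_nonneg _) (Finset.prod_le_one (fun _ _ => abs_nonneg _) ?_)
  intro i _
  exact (PiLp.norm_apply_le w (I i)).trans hw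

theorem hasDerivAt_iteratedFDeriv_line {φ : E n → ℝ} (hφ : ContDiff ℝ ∞ φ) (x w : E n) (k : ℕ)
    (t : ℝ) :
    HasDerivAt (fun s : ℝ => iteratedFDeriv ℝ k φ (x + s • w) fun _ => w)
      (iteratedFDeriv ℝ (k + 1) φ (x + t • w) fun _ => w) t := by
  have h1 : DifferentiableAt ℝ (iteratedFDeriv ℝ k φ) (x + t • w) :=
    hφ.differentiable_iteratedFDeriv (m := k) (by exact_mod_cast ENat.natCast_lt_top k) _
  have h2 : HasDerivAt (fun s : ℝ => x + s • w) w t := by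
    simpa using ((hasDerivAt_id t).smul_const w).const_add x
  have h3 := h1.hasFDerivAt.comp_hasDerivAt t h2
  have h4 := (ContinuousMultilinearMap.apply ℝ (fun _ : Fin k => E n) ℝ
    (fun _ => w)).hasFDerivAt.comp_hasDerivAt t h3
  rw [iteratedFDeriv_succ_apply_left]
  exact h4

end Derivatives

/-! ### The Sobolev estimate at the vertex of a cone -/

section LocalEstimate

variable {n : ℕ}

/-- Cauchy-Schwarz on `B` yields the factor `volume B ^ (1/2)`. The substitution `y = x + t w`
scales the measure by `t ^ (-n)`, and the square root of this appears in the `L²` norm. -/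
theorem lintegral_comp_homothety_le {F : E n → ℝ} (hF : Continuous F) {U B : Set (E n)}
    (hU : MeasurableSet U) {x : E n} {t : ℝ} (ht : 0 < t)
    (hB : ∀ w ∈ B, x + t • w ∈ U) :
    ∫⁻ w in B, ‖F (x + t • w)‖ₑ ≤ volume B ^ (1 / 2 : ℝ) *
      (ENNReal.ofReal (t ^ (-(n / 2 : ℝ))) * eLpNorm F 2 (volume.restrict U)) := by
  have hτ : Measurable fun w : E n => x + t • w := by fun_prop
  have hmap : (volume.map fun w : E n => x + t • w) = ENNReal.ofReal (t ^ (-(n : ℝ))) • volume := by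
    have e : (fun w : E n => x + t • w) = (fun w => x + w) ∘ fun w => t • w := rfl
    rw [e, ← Measure.map_map (by fun_prop) (by fun_prop), Measure.map_addHaar_smul _ ht.ne',
      Measure.map_smul, map_add_left_eq_self, finrank_euclideanSpace, Fintype.card_fin,
      abs_of_pos (by positivity), Real.rpow_neg ht.le, Real.rpow_natCast]
  have hle : ((volume.restrict B).map fun w : E n => x + t • w) ≤
      ENNReal.ofReal (t ^ (-(n : ℝ))) • volume.restrict U := by
    rw [← Measure.restrict_smul, ← hmap, Measure.restrict_map hτ hU]
    exact Measure.map_mono (Measure.restrict_mono_set _ hB) hτ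
  have h1 := eLpNorm_le_eLpNorm_mul_rpow_measure_univ (μ := volume.restrict B)
    (f := fun w => F (x + t • w)) (p := 1) (q := 2) (by norm_num)
    (by fun_prop)
  rw [eLpNorm_one_eq_lintegral_enorm, Measure.restrict_apply_univ] at h1
  refine h1.trans ?_
  rw [mul_comm]
  have e2 : (1 / (1 : ℝ≥0∞).toReal - 1 / (2 : ℝ≥0∞).toReal) = (1 / 2 : ℝ) := by norm_num
  rw [e2]
  gcongr
  have h2 := eLpNorm_map_measure (p := 2) (μ := volume.restrict B) (g := F)
    (f := fun w : E n => x + t • w) (by fun_prop) hτ.aemeasurable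
  change eLpNorm (F ∘ fun w => x + t • w) 2 _ ≤ _
  rw [← h2]
  refine (eLpNorm_mono_measure F hle).trans ?_
  rw [eLpNorm_smul_measure_of_ne_top (by norm_num), smul_eq_mul]
  gcongr
  rw [ENNReal.ofReal_rpow_of_pos (by positivity), ← Real.rpow_mul ht.le]
  refine ENNReal.ofReal_le_ofReal (le_of_eq ?_)
  congr 1
  norm_num
  ring

/-- The Sobolev seminorms of order at most `m`, added up. -/
noncomputable def sobolevSum (U : Set (E n)) (m : ℕ) (φ : E n → ℝ) : ℝ≥0∞ :=
  ∑ k ∈ Finset.range (m + 1), eLpNorm (sumAbsDeriv k φ) 2 (volume.restrict U)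

/-- The pointwise Sobolev estimate at the vertex of a truncated cone contained in `U`. -/
theorem exists_enorm_le_sobolevSum_of_cone (v : E n) {ρ : ℝ} (hρ : 0 < ρ)
    (hv : Metric.ball v ρ ⊆ Metric.closedBall 0 1) {m : ℕ} (hm0 : m ≠ 0)
    (hm : (n : ℝ) / 2 < m) :
    ∃ C : ℝ≥0∞, C ≠ ⊤ ∧ ∀ U : Set (E n), MeasurableSet U → ∀ x : E n,
      (∀ w ∈ Metric.ball v ρ, ∀ t ∈ Set.Ioc (0 : ℝ) 1, x + t • w ∈ U) →
      ∀ φ : E n → ℝ, ContDiff ℝ ∞ φ → ‖φ x‖ₑ ≤ C * sobolevSum U m φ := by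
  -- From here on the order is `m + 1`, so that the Taylor remainder carries the weight `t ^ m`.
  obtain ⟨m, rfl⟩ := Nat.exists_eq_succ_of_ne_zero hm0
  set B := Metric.ball v ρ with hBdef
  set J : ℝ≥0∞ := ∫⁻ t in Set.Ioc (0 : ℝ) 1, ENNReal.ofReal (t ^ m) *
    ENNReal.ofReal (t ^ (-(n / 2 : ℝ))) with hJdef
  have hJ : J ≠ ⊤ := by
    -- The integrand of `J` is `t ^ (m - n/2)`; its exponent exceeds `-1` exactly because the order
    -- `m + 1` exceeds `n/2`.
    have hint := (intervalIntegral.intervalIntegrable_rpow' (a := 0) (b := 1)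
      (r := m - n / 2) (by push_cast at hm; linarith)).1
    refine ne_top_of_le_ne_top hint.2.ne ?_
    refine setLIntegral_mono' measurableSet_Ioc fun t ht => ?_
    rw [← ENNReal.ofReal_mul (by have := ht.1; positivity), ← Real.rpow_natCast,
      ← Real.rpow_add ht.1, ← ofReal_norm,
      Real.norm_of_nonneg (by have := ht.1; positivity)]
    exact le_of_eq (by ring_nf)
  have hB0 : volume B ≠ 0 := (Metric.measure_ball_pos _ _ hρ).ne'
  have hBt : volume B ≠ ⊤ := measure_ball_lt_top.ne
  refine ⟨(volume B)⁻¹ * (volume B ^ (1 / 2 : ℝ) * (1 + J)), ?_, ?_⟩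
  · refine ENNReal.mul_ne_top (ENNReal.inv_ne_top.2 hB0) (ENNReal.mul_ne_top ?_ ?_)
    · exact ENNReal.rpow_ne_top_of_nonneg (by norm_num) hBt
    · exact ENNReal.add_ne_top.2 ⟨ENNReal.one_ne_top, hJ⟩
  intro U hU x hx φ hφ
  have hS := continuous_sumAbsDeriv hφ
  have hnn : ∀ k y, 0 ≤ sumAbsDeriv k φ y := fun k y => Finset.sum_nonneg fun _ _ => abs_nonneg _
  have hen : ∀ k, ∀ w ∈ B, ∀ t : ℝ,
      ‖iteratedFDeriv ℝ k φ (x + t • w) fun _ => w‖ₑ ≤ ‖sumAbsDeriv k φ (x + t • w)‖ₑ := by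
    intro k w hw t
    rw [← ofReal_norm, ← ofReal_norm, Real.norm_of_nonneg (hnn _ _)]
    exact ENNReal.ofReal_le_ofReal
      (abs_iteratedFDeriv_le_sumAbsDeriv φ k _ (by simpa using hv hw))
  have hpt : ∀ w ∈ B, ‖φ x‖ₑ ≤
      ∑ k ∈ Finset.range (m + 1), ‖sumAbsDeriv k φ (x + (1 : ℝ) • w)‖ₑ +
      ∫⁻ t in Set.Ioc (0 : ℝ) 1, ENNReal.ofReal (t ^ m) *
        ‖sumAbsDeriv (m + 1) φ (x + t • w)‖ₑ := by
    intro w hw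
    have := enorm_le_taylor (fun k t => hasDerivAt_iteratedFDeriv_line hφ x w k t) m
    simp only [zero_smul, add_zero, iteratedFDeriv_zero_apply] at this
    refine this.trans ?_
    gcongr with k hk t
    · exact hen k w hw 1
    · exact hen (m + 1) w hw t
  -- Integrate the pointwise bound over `w ∈ B`, exchange the integrals in `w` and `t`, and estimate
  -- the inner one by the homothety lemma.
  have hint : volume B * ‖φ x‖ₑ ≤ volume B ^ (1 / 2 : ℝ) * (1 + J) * sobolevSum U (m + 1) φ := by
    calc volume B * ‖φ x‖ₑ = ∫⁻ _ in B, ‖φ x‖ₑ := by rw [setLIntegral_const, mul_comm]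
      _ ≤ ∫⁻ w in B, (∑ k ∈ Finset.range (m + 1), ‖sumAbsDeriv k φ (x + (1 : ℝ) • w)‖ₑ +
          ∫⁻ t in Set.Ioc (0 : ℝ) 1, ENNReal.ofReal (t ^ m) *
            ‖sumAbsDeriv (m + 1) φ (x + t • w)‖ₑ) :=
        setLIntegral_mono' measurableSet_ball hpt
      _ = ∑ k ∈ Finset.range (m + 1), (∫⁻ w in B, ‖sumAbsDeriv k φ (x + (1 : ℝ) • w)‖ₑ) +
          ∫⁻ t in Set.Ioc (0 : ℝ) 1, ENNReal.ofReal (t ^ m) *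
            ∫⁻ w in B, ‖sumAbsDeriv (m + 1) φ (x + t • w)‖ₑ := by
        have hmeas : ∀ k, Measurable fun w : E n => ‖sumAbsDeriv k φ (x + (1 : ℝ) • w)‖ₑ := by
          intro k
          have := hS k
          exact Continuous.measurable (by fun_prop)
        rw [lintegral_add_left (Finset.measurable_sum _ fun k _ => hmeas k),
          lintegral_finsetSum _ fun k _ => hmeas k]
        congr 1
        rw [lintegral_lintegral_swap]
        · refine lintegral_congr fun t => ?_
          rw [lintegral_const_mul]
          have := hS (m + 1)
          exact Continuous.measurable (by fun_prop)
        · have := hS (m + 1)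
          have h1 : Continuous fun p : E n × ℝ => ENNReal.ofReal (p.2 ^ m) :=
            ENNReal.continuous_ofReal.comp (by fun_prop)
          have h2 : Continuous fun p : E n × ℝ => ‖sumAbsDeriv (m + 1) φ (x + p.2 • p.1)‖ₑ := by
            fun_prop
          exact (h1.measurable.mul h2.measurable).aemeasurable
      _ ≤ ∑ k ∈ Finset.range (m + 1), volume B ^ (1 / 2 : ℝ) *
            eLpNorm (sumAbsDeriv k φ) 2 (volume.restrict U) +
          ∫⁻ t in Set.Ioc (0 : ℝ) 1, ENNReal.ofReal (t ^ m) *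
            (volume B ^ (1 / 2 : ℝ) * (ENNReal.ofReal (t ^ (-(n / 2 : ℝ))) *
              eLpNorm (sumAbsDeriv (m + 1) φ) 2 (volume.restrict U))) := by
        refine add_le_add (Finset.sum_le_sum fun k _ => ?_)
          (setLIntegral_mono' measurableSet_Ioc fun t ht => ?_)
        · have := lintegral_comp_homothety_le (hS k) hU one_pos
            (fun w hw => hx w hw 1 ⟨one_pos, le_rfl⟩)
          simpa using this
        · gcongr
          exact lintegral_comp_homothety_le (hS (m + 1)) hU ht.1 (fun w hw => hx w hw t ht)
      _ = volume B ^ (1 / 2 : ℝ) * (∑ k ∈ Finset.range (m + 1),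
            eLpNorm (sumAbsDeriv k φ) 2 (volume.restrict U) +
            J * eLpNorm (sumAbsDeriv (m + 1) φ) 2 (volume.restrict U)) := by
        rw [mul_add, Finset.mul_sum]
        congr 1
        rw [hJdef, mul_comm _ (eLpNorm _ _ _), ← mul_assoc,
          ← lintegral_const_mul _ (by fun_prop)]
        exact lintegral_congr fun t => by ring
      _ ≤ volume B ^ (1 / 2 : ℝ) * (1 + J) * sobolevSum U (m + 1) φ := by
        rw [mul_assoc, sobolevSum, Finset.sum_range_succ _ (m + 1)]
        gcongr
        set a := ∑ k ∈ Finset.range (m + 1), eLpNorm (sumAbsDeriv k φ) 2 (volume.restrict U)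
        set b := eLpNorm (sumAbsDeriv (m + 1) φ) 2 (volume.restrict U)
        calc a + J * b ≤ (a + J * b) + (b + J * a) := le_self_add
          _ = (1 + J) * (a + b) := by ring
  calc ‖φ x‖ₑ = (volume B)⁻¹ * (volume B * ‖φ x‖ₑ) := by
        rw [← mul_assoc, ENNReal.inv_mul_cancel hB0 hBt, one_mul]
    _ ≤ (volume B)⁻¹ * (volume B ^ (1 / 2 : ℝ) * (1 + J) * sobolevSum U (m + 1) φ) := by gcongr
    _ = _ := by ring

end LocalEstimate

/-! ### Cone property and Sobolev embedding for smooth domains -/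

section SmoothDomain

variable {n : ℕ}

/-- Near each point of its closure, a domain with smooth boundary contains the truncated cones
`x + (0, 1] • ball v ρ` with vertex `x ∈ U`, for a fixed ball. -/
theorem IsSmoothBoundedDomain.exists_cone {U : Set (E n)} (hU : IsSmoothBoundedDomain U) {x₀ : E n}
    (hx₀ : x₀ ∈ closure U) :
    ∃ v : E n, ∃ ρ > 0, Metric.ball v ρ ⊆ Metric.closedBall 0 1 ∧ ∃ N ∈ 𝓝 x₀, ∀ x ∈ N ∩ U,
      ∀ w ∈ Metric.ball v ρ, ∀ t ∈ Set.Ioc (0 : ℝ) 1, x + t • w ∈ U := by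
  by_cases hx : x₀ ∈ U
  · obtain ⟨r, hr, hrU⟩ := Metric.isOpen_iff.1 hU.isOpen x₀ hx
    refine ⟨0, min (r / 2) 1, by positivity, ?_, Metric.ball x₀ (r / 2),
      Metric.ball_mem_nhds _ (by positivity), ?_⟩
    · exact (Metric.ball_subset_ball (min_le_right _ _)).trans Metric.ball_subset_closedBall
    · rintro x ⟨hxN, -⟩ w hw t ht
      apply hrU
      rw [mem_ball_iff_norm] at hxN ⊢
      have hw' : ‖w‖ < r / 2 := (mem_ball_zero_iff.1 hw).trans_le (min_le_left _ _)
      calc ‖x + t • w - x₀‖ = ‖(x - x₀) + t • w‖ := by congr 1; abel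
        _ ≤ ‖x - x₀‖ + t * ‖w‖ := by
          refine (norm_add_le _ _).trans ?_
          rw [norm_smul, Real.norm_of_nonneg ht.1.le]
        _ ≤ ‖x - x₀‖ + 1 * ‖w‖ := by gcongr; exact ht.2
        _ < r := by linarith
  · have hfr : x₀ ∈ frontier U := by
      rw [hU.isOpen.frontier_eq]; exact ⟨hx₀, hx⟩
    obtain ⟨φ, hφ, hν, hloc⟩ := hU.smooth_frontier x₀ hfr
    set ν := gradient φ x₀ with hνdef
    have hd : Differentiable ℝ φ := hφ.differentiable (by simp)
    have hcont : Continuous fun p : E n × E n => fderiv ℝ φ p.1 p.2 :=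
      (((hφ.continuous_fderiv (by simp)).comp continuous_fst).clm_apply continuous_snd)
    have hpos : 0 < fderiv ℝ φ x₀ ν := by
      have h1 : fderiv ℝ φ x₀ ν = inner ℝ ν ν := by
        rw [hνdef, gradient, InnerProductSpace.toDual_symm_apply]
      rw [h1]
      exact real_inner_self_pos.2 hν
    -- The derivative of `φ` is positive at `x₀` in the direction `ν`, hence at all nearby points in
    -- all nearby directions. So `φ` increases along short segments in these directions, and they
    -- cannot leave `{φ > 0}`.
    have hev : ∀ᶠ p : E n × E n in 𝓝 (x₀, ν), 0 < fderiv ℝ φ p.1 p.2 :=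
      hcont.continuousAt.eventually (lt_mem_nhds hpos)
    obtain ⟨δ₁, hδ₁, h₁⟩ := Metric.eventually_nhds_iff_ball.1 hev
    obtain ⟨δ₂, hδ₂, h₂⟩ := Metric.eventually_nhds_iff_ball.1 hloc
    set δ := min δ₁ δ₂ with hδ
    have hδ0 : 0 < δ := lt_min hδ₁ hδ₂
    -- This scaling gives the directions in `ball (s • ν) (s * δ)` norm below `min (δ / 2) 1`: the
    -- cone lies in the unit ball, and segments starting within `δ / 2` of `x₀` stay within `δ`.
    set s := min (δ / 2) 1 / (‖ν‖ + δ) with hs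
    have hνδ : 0 < ‖ν‖ + δ := by positivity
    have hs0 : 0 < s := by positivity
    have hsle : s * (‖ν‖ + δ) = min (δ / 2) 1 := div_mul_cancel₀ _ hνδ.ne'
    have hw : ∀ w ∈ Metric.ball (s • ν) (s * δ), ∃ w' ∈ Metric.ball ν δ, w = s • w' ∧
        ‖w‖ < min (δ / 2) 1 := by
      intro w hw
      refine ⟨s⁻¹ • w, ?_, (smul_inv_smul₀ hs0.ne' w).symm, ?_⟩
      · rw [mem_ball_iff_norm] at hw ⊢
        have : s⁻¹ • w - ν = s⁻¹ • (w - s • ν) := by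
          rw [smul_sub, inv_smul_smul₀ hs0.ne']
        rw [this, norm_smul, norm_inv, Real.norm_of_nonneg hs0.le]
        exact (inv_mul_lt_iff₀ hs0).2 hw
      · rw [← hsle, mul_add]
        rw [mem_ball_iff_norm] at hw
        have h3 := norm_add_le (w - s • ν) (s • ν)
        rw [sub_add_cancel, norm_smul, Real.norm_of_nonneg hs0.le] at h3
        linarith
    refine ⟨s • ν, s * δ, by positivity, ?_, Metric.ball x₀ (δ / 2),
      Metric.ball_mem_nhds _ (by positivity), ?_⟩
    · intro w hwb
      obtain ⟨_, _, _, h3⟩ := hw w hwb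
      simpa using (h3.trans_le (min_le_right _ _)).le
    · rintro x ⟨hxN, hxU⟩ w hwb t ht
      obtain ⟨w', hw', rfl, h3⟩ := hw w hwb
      have hball : ∀ τ ∈ Set.Icc (0 : ℝ) 1, x + τ • s • w' ∈ Metric.ball x₀ δ := by
        intro τ hτ
        rw [mem_ball_iff_norm] at hxN ⊢
        have h4 : ‖s • w'‖ < δ / 2 := h3.trans_le (min_le_left _ _)
        calc ‖x + τ • s • w' - x₀‖ = ‖(x - x₀) + τ • s • w'‖ := by congr 1; abel
          _ ≤ ‖x - x₀‖ + τ * ‖s • w'‖ := by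
            refine (norm_add_le _ _).trans ?_
            rw [norm_smul τ, Real.norm_of_nonneg hτ.1]
          _ ≤ ‖x - x₀‖ + 1 * ‖s • w'‖ := by gcongr; exact hτ.2
          _ < δ := by linarith
      have hiff : ∀ y ∈ Metric.ball x₀ δ, (y ∈ U ↔ 0 < φ y) := fun y hy =>
        h₂ y (Metric.ball_subset_ball (min_le_right _ _) hy)
      have hderiv : ∀ τ : ℝ, HasDerivAt (fun τ : ℝ => φ (x + τ • s • w'))
          (fderiv ℝ φ (x + τ • s • w') (s • w')) τ := by
        intro τ
        have h5 : HasDerivAt (fun τ : ℝ => x + τ • s • w') (s • w') τ := by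
          simpa using ((hasDerivAt_id τ).smul_const (s • w')).const_add x
        exact (hd _).hasFDerivAt.comp_hasDerivAt τ h5
      have hmono : MonotoneOn (fun τ : ℝ => φ (x + τ • s • w')) (Set.Icc 0 1) := by
        refine monotoneOn_of_deriv_nonneg (convex_Icc 0 1)
          (fun τ _ => (hderiv τ).continuousAt.continuousWithinAt)
          (fun τ _ => (hderiv τ).differentiableAt.differentiableWithinAt) fun τ hτ => ?_
        rw [(hderiv τ).deriv, map_smul, smul_eq_mul]
        refine mul_nonneg hs0.le (h₁ (x + τ • s • w', w') ?_).le
        rw [← ball_prod_same]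
        exact ⟨Metric.ball_subset_ball (min_le_left _ _) (hball τ (interior_subset hτ)),
          Metric.ball_subset_ball (min_le_left _ _) hw'⟩
      have h6 := hmono ⟨le_rfl, zero_le_one⟩ ⟨ht.1.le, ht.2⟩ ht.1.le
      have hx0 : 0 < φ x := by
        refine (hiff x ?_).1 hxU
        simpa using hball 0 ⟨le_rfl, zero_le_one⟩
      rw [hiff _ (hball t ⟨ht.1.le, ht.2⟩)]
      simp only [zero_smul, add_zero] at h6
      exact hx0.trans_le h6

/-- The Sobolev inequality for smooth functions. -/
theorem IsSmoothBoundedDomain.exists_enorm_le_sobolevSum {U : Set (E n)}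
    (hU : IsSmoothBoundedDomain U) {m : ℕ} (hm0 : m ≠ 0) (hm : (n : ℝ) / 2 < m) :
    ∃ C : ℝ≥0∞, C ≠ ⊤ ∧ ∀ φ : E n → ℝ, ContDiff ℝ ∞ φ → ∀ x ∈ U,
      ‖φ x‖ₑ ≤ C * sobolevSum U m φ := by
  -- The constant depends only on the cone, so it is uniform near each point of the closure.
  -- Compactness leaves finitely many constants, which are added.
  obtain ⟨C, hC, h⟩ := hU.isBounded.isCompact_closure.induction_on
    (p := fun s => ∃ C : ℝ≥0∞, C ≠ ⊤ ∧ ∀ φ : E n → ℝ, ContDiff ℝ ∞ φ → ∀ x ∈ s ∩ U,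
      ‖φ x‖ₑ ≤ C * sobolevSum U m φ)
    ⟨0, by simp, by simp⟩
    (fun s t hst ⟨C, hC, h⟩ => ⟨C, hC, fun φ hφ x hx => h φ hφ x ⟨hst hx.1, hx.2⟩⟩)
    (by
      rintro s t ⟨C, hC, h⟩ ⟨C', hC', h'⟩
      refine ⟨C + C', ENNReal.add_ne_top.2 ⟨hC, hC'⟩, ?_⟩
      rintro φ hφ x ⟨hx | hx, hxU⟩
      · exact (h φ hφ x ⟨hx, hxU⟩).trans (by gcongr; exact le_self_add)
      · exact (h' φ hφ x ⟨hx, hxU⟩).trans (by gcongr; exact le_add_self))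
    (by
      intro x₀ hx₀
      obtain ⟨v, ρ, hρ, hv, N, hN, hcone⟩ := hU.exists_cone hx₀
      obtain ⟨C, hC, h⟩ := exists_enorm_le_sobolevSum_of_cone v hρ hv hm0 hm
      exact ⟨N, mem_nhdsWithin_of_mem_nhds hN, C, hC, fun φ hφ x hx =>
        h U hU.isOpen.measurableSet x (hcone x hx) φ hφ⟩)
  exact ⟨C, hC, fun φ hφ x hx => h φ hφ x ⟨subset_closure hx, hx⟩⟩

theorem partialDeriv_zero (I : Fin 0 → Fin n) (φ : E n → ℝ) : partialDeriv I φ = φ := by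
  funext x
  simp [partialDeriv]

theorem weakDeriv_zero {U : Set (E n)} (hU : IsOpen U) (I : Fin 0 → Fin n) (u : L2 U) :
    weakDeriv U I u = u := by
  have h : HasWeakDeriv U I u u := fun φ _ _ _ => by simp [partialDeriv_zero]
  have hex : ∃ g : L2 U, HasWeakDeriv U I u g := ⟨u, h⟩
  rw [weakDeriv, dif_pos hex]
  exact hex.choose_spec.unique hU h

/-- The Sobolev embedding into the bounded functions, for functions that can be approximated by
smooth ones. -/
theorem BoundaryCondition.memLp_top {U : Set (E n)} (hU : IsSmoothBoundedDomain U) {m : ℕ}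
    (hm0 : m ≠ 0) (hm : (n : ℝ) / 2 < m) {b : Coeffs n} {r : ℕ} {u : L2 U}
    (hu : BoundaryCondition U m b r u) : MemLp u ⊤ (volume.restrict U) := by
  obtain ⟨φ, hφ, hlim, -⟩ := hu
  obtain ⟨C, hC, hsob⟩ := hU.exists_enorm_le_sobolevSum hm0 hm
  set M : ℝ≥0∞ := ∑ k ∈ Finset.range (m + 1), ∑ I : Fin k → Fin n,
    eLpNorm (weakDeriv U I u) 2 (volume.restrict U) with hM
  have hMtop : M ≠ ⊤ := by
    simp only [hM, ne_eq, ENNReal.sum_eq_top, not_exists, not_and]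
    exact fun k _ I _ => (Lp.memLp _).2.ne
  have hle : ∀ i, sobolevSum U m (φ i) ≤ ∑ k ∈ Finset.range (m + 1), ∑ I : Fin k → Fin n,
      (eLpNorm (fun x => partialDeriv I (φ i) x - weakDeriv U I u x) 2 (volume.restrict U) +
        eLpNorm (weakDeriv U I u) 2 (volume.restrict U)) := by
    intro i
    refine Finset.sum_le_sum fun k _ => ?_
    have h1 : sumAbsDeriv k (φ i) = ∑ I : Fin k → Fin n, fun x => |partialDeriv I (φ i) x| := by
      funext x
      simp [sumAbsDeriv]
    rw [h1]
    refine (eLpNorm_sum_le (fun I _ => ?_) (by norm_num)).trans (Finset.sum_le_sum fun I _ => ?_)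
    · exact (continuous_partialDeriv (hφ i) I).abs.aestronglyMeasurable
    · have h2 : eLpNorm (fun x => |partialDeriv I (φ i) x|) 2 (volume.restrict U) =
          eLpNorm ((fun x => partialDeriv I (φ i) x - weakDeriv U I u x) + ⇑(weakDeriv U I u)) 2
            (volume.restrict U) := by
        refine (eLpNorm_norm (partialDeriv I (φ i))).trans ?_
        congr 1
        funext x
        simp
      rw [h2]
      exact eLpNorm_add_le ((continuous_partialDeriv (hφ i) I).aestronglyMeasurable.sub
        (Lp.aestronglyMeasurable _)) (Lp.aestronglyMeasurable _) (by norm_num)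
  have htend : Tendsto (fun i => ∑ k ∈ Finset.range (m + 1), ∑ I : Fin k → Fin n,
      (eLpNorm (fun x => partialDeriv I (φ i) x - weakDeriv U I u x) 2 (volume.restrict U) +
        eLpNorm (weakDeriv U I u) 2 (volume.restrict U))) atTop (𝓝 M) := by
    refine tendsto_finsetSum _ fun k hk => tendsto_finsetSum _ fun I _ => ?_
    simpa using (hlim k (Nat.lt_succ_iff.1 (Finset.mem_range.1 hk)) I).add_const
      (eLpNorm (weakDeriv U I u) 2 (volume.restrict U))
  -- The bounds for `sobolevSum U m (φ i)` tend to `M < ⊤`, so they are eventually below `M + 1`.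
  have hbound : ∀ᶠ i in atTop, ∀ x ∈ U, ‖φ i x‖ ≤ (C * (M + 1)).toReal := by
    filter_upwards [htend.eventually_lt_const (ENNReal.lt_add_right hMtop one_ne_zero)]
      with i hi x hx
    rw [← toReal_enorm]
    refine ENNReal.toReal_mono (ENNReal.mul_ne_top hC (by simp [hMtop])) ?_
    refine (hsob (φ i) (hφ i) x hx).trans ?_
    gcongr
    exact (hle i).trans hi.le
  have h0 := hlim 0 (Nat.zero_le _) Fin.elim0
  rw [weakDeriv_zero hU.isOpen] at h0
  simp_rw [partialDeriv_zero] at h0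
  -- A subsequence converges to `u` almost everywhere, so the uniform bound passes to `u`.
  obtain ⟨ns, hns, hae⟩ := (tendstoInMeasure_of_tendsto_eLpNorm (by norm_num)
    (fun i => (hφ i).continuous.aestronglyMeasurable) (Lp.aestronglyMeasurable u)
    h0).exists_seq_tendsto_ae
  refine memLp_top_of_bound (Lp.aestronglyMeasurable u) (C * (M + 1)).toReal ?_
  filter_upwards [hae, ae_restrict_mem hU.isOpen.measurableSet] with x hx hxU
  refine le_of_tendsto hx.norm ?_
  filter_upwards [hns.tendsto_atTop.eventually hbound] with i hi using hi x hxU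

end SmoothDomain

/-! ### Positivity from the spectral theorem -/

section PositiveCompact

variable {H : Type*} [NormedAddCommGroup H] [InnerProductSpace ℝ H] [CompleteSpace H]

/-- A compact self-adjoint operator with nonnegative eigenvalues is nonnegative. -/
theorem inner_apply_self_nonneg_of_eigenvalues_nonneg {T : H →L[ℝ] H} (hT : IsCompactOperator T)
    (hsa : IsSelfAdjoint T) (hev : ∀ (μ : ℝ) (f : H), f ≠ 0 → T f = μ • f → 0 ≤ μ) (f : H) :
    0 ≤ inner ℝ (T f) f := by
  have hsymm : (T : H →ₗ[ℝ] H).IsSymmetric := hsa.isSymmetric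
  have hdense := Submodule.topologicalClosure_eq_top_iff.2
    (ContinuousLinearMap.orthogonalComplement_iSup_eigenspaces_eq_bot hT hsymm)
  have hclosed : IsClosed {f : H | 0 ≤ inner ℝ (T f) f} :=
    isClosed_le continuous_const (T.continuous.inner continuous_id)
  -- On a finite sum of eigenvectors the mixed terms vanish by orthogonality, and the form reduces
  -- to the sum of `μ ‖c μ‖²`.
  have hsub : ((⨆ μ, Module.End.eigenspace (T : H →ₗ[ℝ] H) μ : Submodule ℝ H) : Set H) ⊆
      {f : H | 0 ≤ inner ℝ (T f) f} := by
    intro x hx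
    obtain ⟨c, hc, rfl⟩ := (Submodule.mem_iSup_iff_exists_finsupp _ _).1 hx
    have hTc : ∀ μ, T (c μ) = μ • c μ := fun μ => Module.End.mem_eigenspace_iff.1 (hc μ)
    have horth : ∀ μ ν, μ ≠ ν → inner ℝ (c μ) (c ν) = 0 := fun μ ν hμν =>
      hsymm.orthogonalFamily_eigenspaces.pairwise hμν.symm (hc ν) (c μ) (hc μ)
    simp only [Set.mem_ofPred_eq, Finsupp.sum, map_sum, sum_inner, inner_sum]
    refine Finset.sum_nonneg fun μ _ => Finset.sum_nonneg fun ν _ => ?_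
    rw [hTc, real_inner_smul_left]
    rcases eq_or_ne ν μ with rfl | hμν
    · by_cases h0 : c ν = 0
      · simp [h0]
      · exact mul_nonneg (hev ν (c ν) h0 (hTc ν)) real_inner_self_nonneg
    · rw [horth ν μ hμν, mul_zero]
  have hmem : f ∈ closure ((⨆ μ, Module.End.eigenspace (T : H →ₗ[ℝ] H) μ : Submodule ℝ H) :
      Set H) := by
    rw [← Submodule.topologicalClosure_coe, hdense]
    trivial
  exact closure_minimal hsub hclosed hmem

end PositiveCompact

/-! ### Tensor products in `L²` -/

section Tensor

variable {X : Type*} [MeasurableSpace X] {μ : Measure X}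

theorem memLp_tensor {f g : X → ℝ} (hf : MemLp f 2 μ) (hg : MemLp g 2 μ) :
    MemLp (fun p : X × X => f p.1 * g p.2) 2 (μ.prod μ) := by
  refine (memLp_two_iff_integrable_sq (hf.1.comp_fst.mul hg.1.comp_snd)).2 ?_
  refine Integrable.congr ?_ (Eventually.of_forall fun p => (mul_pow (f p.1) (g p.2) 2).symm)
  exact ((memLp_two_iff_integrable_sq hf.1).1 hf).mul_prod
    ((memLp_two_iff_integrable_sq hg.1).1 hg)

/-- The function `(x, ξ) ↦ f x * g ξ`. -/
noncomputable def tensor (f g : Lp ℝ 2 μ) : Lp ℝ 2 (μ.prod μ) :=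
  (memLp_tensor (Lp.memLp f) (Lp.memLp g)).toLp _

theorem coeFn_tensor (f g : Lp ℝ 2 μ) :
    tensor f g =ᵐ[μ.prod μ] fun p => f p.1 * g p.2 := MemLp.coeFn_toLp _

theorem inner_tensor_right (K : Lp ℝ 2 (μ.prod μ)) (f g : Lp ℝ 2 μ) :
    inner ℝ K (tensor g f) = ∫ p, g p.1 * (K p * f p.2) ∂μ.prod μ := by
  rw [L2.inner_def]
  refine integral_congr_ae ?_
  filter_upwards [coeFn_tensor g f] with p h
  rw [h]
  simp only [RCLike.inner_apply, conj_trivial]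
  ring

variable [SFinite μ]

theorem inner_tensor (f g f' g' : Lp ℝ 2 μ) :
    inner ℝ (tensor f g) (tensor f' g') = inner ℝ f f' * inner ℝ g g' := by
  rw [L2.inner_def, L2.inner_def, L2.inner_def, ← integral_prod_mul]
  refine integral_congr_ae ?_
  filter_upwards [coeFn_tensor f g, coeFn_tensor f' g'] with p h1 h2
  rw [h1, h2]
  simp only [RCLike.inner_apply, conj_trivial]
  ring

theorem norm_tensor (f g : Lp ℝ 2 μ) : ‖tensor f g‖ = ‖f‖ * ‖g‖ := by
  have h := inner_tensor f g f g
  simp only [real_inner_self_eq_norm_sq] at h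
  rw [← mul_pow] at h
  exact (sq_eq_sq₀ (norm_nonneg _) (by positivity)).1 h

end Tensor

/-! ### Operators from `L²` to `L^∞` and their kernels -/

section HilbertSchmidt

variable {X : Type*} [MeasurableSpace X] {μ : Measure X}

/-- A bounded operator on `L²` with values in `L^∞` is bounded as an operator into `L^∞`. -/
theorem exists_ae_norm_le_of_memLp_top (G : Lp ℝ 2 μ →L[ℝ] Lp ℝ 2 μ)
    (hG : ∀ f, MemLp (G f) ⊤ μ) : ∃ C : ℝ, ∀ f, ∀ᵐ x ∂μ, |G f x| ≤ C * ‖f‖ := by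
  let T : Lp ℝ 2 μ →ₗ[ℝ] Lp ℝ ⊤ μ :=
    { toFun := fun f => (hG f).toLp _
      map_add' := fun f g => by
        rw [← MemLp.toLp_add]
        refine MemLp.toLp_congr _ _ ?_
        rw [map_add]
        exact Lp.coeFn_add _ _
      map_smul' := fun c f => by
        rw [RingHom.id_apply, ← MemLp.toLp_const_smul]
        refine MemLp.toLp_congr _ _ ?_
        rw [map_smul]
        exact Lp.coeFn_smul _ _ }
  have hT : ∀ f, T f =ᵐ[μ] G f := fun f => (hG f).coeFn_toLp
  have hcont : Continuous T := by
    -- Convergence in `L²` and in `L^∞` both imply convergence in measure, whose limit is unique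
    -- almost everywhere; so the graph is closed.
    refine T.continuous_of_seq_closed_graph fun u f g hu hg => ?_
    have h1 : Tendsto (fun i => G (u i)) atTop (𝓝 (G f)) := (G.continuous.tendsto f).comp hu
    have h2 : TendstoInMeasure μ (fun i => ⇑(G (u i))) atTop (G f) := tendstoInMeasure_of_tendsto_Lp h1
    have h3 : TendstoInMeasure μ (fun i => ⇑(T (u i))) atTop g := tendstoInMeasure_of_tendsto_Lp hg
    have h4 : TendstoInMeasure μ (fun i => ⇑(G (u i))) atTop g :=
      h3.congr_left fun i => hT (u i)
    exact Lp.ext ((tendstoInMeasure_ae_unique h4 h2).trans (hT f).symm)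
  let T' : Lp ℝ 2 μ →L[ℝ] Lp ℝ ⊤ μ := ⟨T, hcont⟩
  refine ⟨‖T'‖, fun f => ?_⟩
  have h1 : ‖T f‖ ≤ ‖T'‖ * ‖f‖ := T'.le_opNorm f
  have h2 : ∀ᵐ x ∂μ, ‖T f x‖ ≤ ‖T f‖ := by
    rw [Lp.norm_def]
    filter_upwards [ae_le_eLpNormEssSup (f := T f) (μ := μ)] with x hx
    rw [← toReal_enorm]
    refine ENNReal.toReal_mono (Lp.eLpNorm_ne_top _) ?_
    rwa [eLpNorm_exponent_top]
  filter_upwards [h2, hT f] with x hx hx'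
  rw [← hx']
  exact hx.trans h1

variable [IsFiniteMeasure μ]

/-- A bounded operator from `L²` to `L^∞` is a Hilbert-Schmidt operator. -/
theorem sum_norm_sq_le_of_ae_norm_le (G : Lp ℝ 2 μ →L[ℝ] Lp ℝ 2 μ) {C : ℝ}
    (hG : ∀ f, ∀ᵐ x ∂μ, |G f x| ≤ C * ‖f‖) {ι : Type*} {e : ι → Lp ℝ 2 μ}
    (he : Orthonormal ℝ e) (s : Finset ι) : ∑ i ∈ s, ‖G (e i)‖ ^ 2 ≤ C ^ 2 * μ.real Set.univ := by
  have hcoe : ∀ c : s → ℝ, ∀ᵐ x ∂μ, G (∑ i, c i • e i) x = ∑ i, c i * G (e i) x := by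
    intro c
    rw [map_sum]
    have h1 : ∀ᵐ x ∂μ, ∀ i : s, (c i • G (e i) : Lp ℝ 2 μ) x = c i * G (e i) x :=
      ae_all_iff.2 fun i => Lp.coeFn_smul (c i) (G (e i))
    filter_upwards [Lp.coeFn_finsetSum Finset.univ fun i : s => G (c i • e i), h1] with x hx hx1
    rw [hx]
    simp only [map_smul, Finset.sum_apply, hx1]
  have hnorm : ∀ c : s → ℝ, ‖∑ i, c i • e i‖ ^ 2 = ∑ i, c i ^ 2 := by
    intro c
    have := (he.comp (fun i : s => (i : ι)) Subtype.val_injective).inner_sum c c Finset.univ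
    rw [← real_inner_self_eq_norm_sq]
    simpa [sq] using this
  -- The exceptional null set depends on `c`. Countably many rational vectors allow a common one,
  -- and real vectors follow by density for each fixed `x`.
  have hQ : ∀ᵐ x ∂μ, ∀ c : s → ℚ,
      (∑ i, (c i : ℝ) * G (e i) x) ^ 2 ≤ C ^ 2 * ∑ i, (c i : ℝ) ^ 2 := by
    refine ae_all_iff.2 fun c => ?_
    filter_upwards [hcoe fun i => c i, hG (∑ i, (c i : ℝ) • e i)] with x h1 h2
    rw [h1] at h2
    rw [← hnorm fun i => (c i : ℝ), ← mul_pow, ← sq_abs]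
    gcongr
  have hR : ∀ᵐ x ∂μ, ∑ i : s, (G (e i) x) ^ 2 ≤ C ^ 2 := by
    filter_upwards [hQ] with x hx
    have hd : DenseRange fun (c : s → ℚ) (i : s) => (c i : ℝ) :=
      DenseRange.piMap fun _ => Rat.denseRange_cast
    have hall : ∀ c : s → ℝ, (∑ i, c i * G (e i) x) ^ 2 ≤ C ^ 2 * ∑ i, c i ^ 2 := by
      intro c
      refine hd.induction_on c (isClosed_le (by fun_prop) (by fun_prop)) hx
    -- This choice of `c` turns the bound into `S² ≤ C² S`.
    have h1 := hall fun i => G (e i) x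
    simp only [← sq] at h1
    set S := ∑ i : s, (G (e i) x) ^ 2 with hS
    have hS0 : 0 ≤ S := Finset.sum_nonneg fun _ _ => sq_nonneg _
    rcases hS0.eq_or_lt with h | h
    · rw [← h]; positivity
    · rw [sq S] at h1
      exact le_of_mul_le_mul_right h1 h
  have hint : ∀ f : Lp ℝ 2 μ, Integrable (fun x => (f x) ^ 2) μ := fun f =>
    (memLp_two_iff_integrable_sq (Lp.aestronglyMeasurable f)).1 (Lp.memLp f)
  have hn : ∀ f : Lp ℝ 2 μ, ‖f‖ ^ 2 = ∫ x, (f x) ^ 2 ∂μ := by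
    intro f
    rw [← real_inner_self_eq_norm_sq, L2.inner_def]
    simp [sq]
  rw [← Finset.sum_coe_sort]
  simp_rw [hn]
  rw [← integral_finsetSum _ fun i _ => hint _]
  calc ∫ x, ∑ i : s, (G (e i) x) ^ 2 ∂μ ≤ ∫ _, C ^ 2 ∂μ :=
        integral_mono_ae (integrable_finsetSum _ fun i _ => hint _) (integrable_const _) hR
    _ = C ^ 2 * μ.real Set.univ := by rw [integral_const, smul_eq_mul, mul_comm]

/-- A bounded operator on `L²` with values in `L^∞` is compact and represented by a square
integrable kernel. -/
theorem exists_kernel_of_memLp_top (G : Lp ℝ 2 μ →L[ℝ] Lp ℝ 2 μ)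
    (hG : ∀ f, MemLp (G f) ⊤ μ) : IsCompactOperator G ∧
      ∃ K : Lp ℝ 2 (μ.prod μ), ∀ f g, inner ℝ K (tensor g f) = inner ℝ (G f) g := by
  obtain ⟨C, hb⟩ := exists_ae_norm_le_of_memLp_top G hG
  obtain ⟨w, b, -⟩ := exists_hilbertBasis ℝ (Lp ℝ 2 μ)
  have hsum : Summable fun i => ‖G (b i)‖ ^ 2 :=
    summable_of_sum_le (fun _ => sq_nonneg _) (sum_norm_sq_le_of_ae_norm_le G hb b.orthonormal)
  have hortho : ∀ i j, i ≠ j →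
      inner ℝ (tensor (G (b i)) (b i)) (tensor (G (b j)) (b j)) = 0 := by
    intro i j hij
    rw [inner_tensor, b.orthonormal.2 hij, mul_zero]
  have hKsum : Summable fun i => tensor (G (b i)) (b i) := by
    -- The terms are pairwise orthogonal, so summability only requires their squared norms `‖G (b
    -- i)‖²` to be summable.
    have hV : OrthogonalFamily ℝ (fun i => ℝ ∙ tensor (G (b i)) (b i))
        fun i => (ℝ ∙ tensor (G (b i)) (b i)).subtypeₗᵢ := by
      refine OrthogonalFamily.of_pairwise fun i j hij => Submodule.isOrtho_span.2 ?_
      rintro _ rfl _ rfl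
      exact hortho i j hij
    refine (hV.summable_iff_norm_sq_summable fun i =>
      ⟨_, Submodule.mem_span_singleton_self (tensor (G (b i)) (b i))⟩).2 ?_
    simpa [norm_tensor, b.orthonormal.1] using hsum
  obtain ⟨K, hK⟩ := hKsum
  have hinner : ∀ f g, inner ℝ K (tensor g f) = inner ℝ (G f) g := by
    intro f g
    have h1 : HasSum (fun i => inner ℝ (tensor (G (b i)) (b i)) (tensor g f))
        (inner ℝ K (tensor g f)) := hK.mapL ((innerSL ℝ).flip (tensor g f))
    have h2 : HasSum (fun i => inner ℝ (b.repr f i • G (b i)) g) (inner ℝ (G f) g) := by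
      have := ((b.hasSum_repr f).mapL G).mapL ((innerSL ℝ).flip g)
      simpa only [map_smul, ContinuousLinearMap.flip_apply, innerSL_apply_apply, smul_eq_mul,
        real_inner_smul_left] using this
    refine h1.unique ?_
    convert h2 using 2 with i
    rw [inner_tensor, real_inner_smul_left, b.repr_apply_apply, mul_comm]
  refine ⟨?_, K, hinner⟩
  -- These finite rank operators have the partial sums of `K` as kernels. The operator norm is at
  -- most the `L²` norm of the kernel, so they converge to `G`, which is therefore compact.
  let Gs : Finset w → Lp ℝ 2 μ →L[ℝ] Lp ℝ 2 μ := fun s =>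
    ∑ i ∈ s, (innerSL ℝ (b i)).smulRight (G (b i))
  have hGs : ∀ s f g, inner ℝ (∑ i ∈ s, tensor (G (b i)) (b i)) (tensor g f) =
      inner ℝ (Gs s f) g := by
    intro s f g
    simp only [Gs, sum_inner, sum_apply, ContinuousLinearMap.smulRight_apply,
      innerSL_apply_apply, real_inner_smul_left, inner_tensor]
    exact Finset.sum_congr rfl fun i _ => mul_comm _ _
  have hdist : ∀ s, ‖Gs s - G‖ ≤ ‖∑ i ∈ s, tensor (G (b i)) (b i) - K‖ := by
    intro s
    refine ContinuousLinearMap.opNorm_le_bound _ (norm_nonneg _) fun f => ?_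
    set h := (Gs s - G) f with hh
    -- Pair the difference of kernels with `tensor h f`: this gives `⟨(Gs s - G) f, h⟩ = ‖h‖²`.
    have h1 : ‖h‖ ^ 2 ≤ ‖∑ i ∈ s, tensor (G (b i)) (b i) - K‖ * (‖h‖ * ‖f‖) := by
      rw [← norm_tensor, ← real_inner_self_eq_norm_sq]
      refine le_trans (le_of_eq ?_) (real_inner_le_norm _ _)
      rw [inner_sub_left, hGs, hinner, ← inner_sub_left]
      rfl
    rcases (norm_nonneg h).eq_or_lt with h0 | h0
    · rw [← h0]; positivity
    · refine le_of_mul_le_mul_right ?_ h0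
      linarith
  refine isCompactOperator_of_tendsto (l := atTop) (F := Gs) ?_ (Eventually.of_forall fun s => ?_)
  · rw [tendsto_iff_norm_sub_tendsto_zero]
    exact squeeze_zero (fun _ => norm_nonneg _) hdist
      (tendsto_iff_norm_sub_tendsto_zero.1 hK)
  · refine (compactOperator (RingHom.id ℝ) (Lp ℝ 2 μ) (Lp ℝ 2 μ)).sum_mem fun i _ => ?_
    exact ((isCompactOperator_of_locallyCompactSpace_dom (ContinuousLinearMap.id ℝ ℝ)).comp_clm
      (innerSL ℝ (b i))).clm_comp
      (ContinuousLinearMap.toSpanSingleton ℝ (G (b i)))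

/-- Testing against indicators, which lie in `L²` as the measure is finite, and Fubini show that
both sides have the same integral over every measurable set. -/
theorem ae_eq_integral_of_inner_tensor {G : Lp ℝ 2 μ →L[ℝ] Lp ℝ 2 μ} {K : Lp ℝ 2 (μ.prod μ)}
    (h : ∀ f g, inner ℝ K (tensor g f) = inner ℝ (G f) g) (f : Lp ℝ 2 μ) :
    G f =ᵐ[μ] fun x => ∫ ξ, K (x, ξ) * f ξ ∂μ := by
  have hint : ∀ g : X → ℝ, MemLp g 2 μ →
      Integrable (fun p : X × X => g p.1 * (K p * f p.2)) (μ.prod μ) := by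
    intro g hg
    have := (Lp.memLp K).integrable_mul (memLp_tensor hg (Lp.memLp f))
    refine this.congr (Eventually.of_forall fun p => ?_)
    simp only [Pi.mul_apply]
    ring
  have hKf : Integrable (fun p : X × X => K p * f p.2) (μ.prod μ) := by
    simpa using hint (fun _ => 1) (memLp_const 1)
  refine Integrable.ae_eq_of_forall_setIntegral_eq _ _ ((Lp.memLp (G f)).integrable (by norm_num))
    hKf.integral_prod_left fun s hs _ => ?_
  have hg : MemLp (s.indicator fun _ => (1 : ℝ)) 2 μ := (memLp_const 1).indicator hs
  have e := h f (hg.toLp _)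
  have e1 : inner ℝ (G f) (hg.toLp _) = ∫ x in s, G f x ∂μ := by
    rw [L2.inner_def, ← integral_indicator hs]
    refine integral_congr_ae ?_
    filter_upwards [hg.coeFn_toLp] with x hx
    rw [hx]
    by_cases hxs : x ∈ s <;> simp [hxs]
  rw [← e1, ← e, inner_tensor_right]
  have e2 : (fun p : X × X => (hg.toLp _ : Lp ℝ 2 μ) p.1 * (K p * f p.2)) =ᵐ[μ.prod μ]
      fun p => s.indicator (fun _ => (1 : ℝ)) p.1 * (K p * f p.2) := by
    filter_upwards [Measure.quasiMeasurePreserving_fst.ae_eq_comp hg.coeFn_toLp] with p hp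
    simp only [Function.comp_apply] at hp
    rw [hp]
  rw [integral_congr_ae e2, integral_prod _ (hint _ hg), ← integral_indicator hs]
  refine integral_congr_ae (Eventually.of_forall fun x => ?_)
  by_cases hxs : x ∈ s <;> simp [hxs]

end HilbertSchmidt

/-! ### Consequences of admissibility and positivity -/

namespace Collection

variable {n : ℕ} {P : Collection n}

theorem memLp_top_of_mem_domain (hP : P.IsAdmissible) (hn : 0 < n)
    (hm : (n : ℝ) / 2 < (P.m : ℝ)) {u : L2 P.U} (hu : u ∈ P.domain) :
    MemLp u ⊤ (volume.restrict P.U) := by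
  have hm0 : P.m ≠ 0 := by
    intro h
    have : (0 : ℝ) < n := by exact_mod_cast hn
    rw [h, Nat.cast_zero] at hm
    linarith
  -- As `m` is even and nonzero, at least one boundary condition exists; it provides the
  -- approximating smooth functions.
  have hm2 : 0 < P.m / 2 := by
    obtain ⟨k, hk⟩ := hP.even_m
    omega
  exact (hu.2 ⟨0, hm2⟩).memLp_top hP.domain_U hm0 hm

/-- The eigenvalues of the inverse of a positive `A` are nonnegative. -/
theorem IsPositive.nonneg_of_inverse_apply_eq_smul (hpos : P.IsPositive)
    {G : L2 P.U →L[ℝ] L2 P.U} (hG : ∀ f, P.IsSolution f (G f)) {lam : ℝ} {f : L2 P.U}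
    (hf : f ≠ 0) (h : G f = lam • f) : 0 ≤ lam := by
  rcases eq_or_ne lam 0 with h0 | h0
  · exact h0.ge
  have h1 : P.IsSolution (lam⁻¹ • f) f := by
    have := hG (lam⁻¹ • f)
    rwa [map_smul, h, inv_smul_smul₀ h0] at this
  have h2 : P.IsSolution 0 (0 : L2 P.U) := by
    simpa using hG 0
  -- The real eigenvector `f` is viewed as the complex one `f + i 0`, with eigenvalue `lam⁻¹` of
  -- `A`.
  have h3 := hpos (lam⁻¹ : ℝ) ⟨f, 0, Or.inl hf, by simpa using h1, by simpa using h2⟩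
  exact (inv_pos.1 (by simpa using h3.2)).le

end Collection

end GreenPositivity

open GreenPositivity in
theorem theorem2p1 (n : ℕ) (hn : 0 < n) (P : GreenPositivity.Collection n)
    (hP : P.IsAdmissible) (hpos : P.IsPositive) (hm : (n : ℝ) / 2 < (P.m : ℝ)) :
    (∃ K : GreenPositivity.E n → GreenPositivity.E n → ℝ, P.IsGreensFunction K) ∧
    ∀ K : GreenPositivity.E n → GreenPositivity.E n → ℝ, P.IsGreensFunction K →
      ∀ z : GreenPositivity.E n → ℝ, MemLp z 2 (volume.restrict P.U) →
        Integrable (fun p : GreenPositivity.E n × GreenPositivity.E n =>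
          z p.1 * K p.1 p.2 * z p.2)
          ((volume.restrict P.U).prod (volume.restrict P.U)) ∧
        0 ≤ ∫ x in P.U, ∫ ξ in P.U, z x * K x ξ * z ξ := by
  obtain ⟨G, hG, hsa⟩ := hP.selfAdjoint
  have : IsFiniteMeasure (volume.restrict P.U) :=
    isFiniteMeasure_restrict.2 hP.domain_U.isBounded.measure_lt_top.ne
  have htop : ∀ f, MemLp (G f) ⊤ (volume.restrict P.U) := fun f =>
    Collection.memLp_top_of_mem_domain hP hn hm (hG f).1
  obtain ⟨hcomp, K₀, hK₀⟩ := exists_kernel_of_memLp_top G htop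
  refine ⟨⟨fun x ξ => K₀ (x, ξ), Lp.memLp K₀, fun f u hu => ?_⟩, fun K hK z hz => ⟨?_, ?_⟩⟩
  · rw [(hP.bijective f).unique hu (hG f)]
    exact ae_eq_integral_of_inner_tensor hK₀ f
  · have := hK.1.integrable_mul (memLp_tensor hz hz)
    refine this.congr (Eventually.of_forall fun p => ?_)
    simp only [Pi.mul_apply, Function.uncurry]
    ring
  · have hzL := hz.coeFn_toLp
    have hpair := inner_apply_self_nonneg_of_eigenvalues_nonneg hcomp hsa
      (fun _ _ hf h => hpos.nonneg_of_inverse_apply_eq_smul hG hf h) (hz.toLp z)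
    refine hpair.trans (le_of_eq ?_)
    rw [L2.inner_def]
    refine integral_congr_ae ?_
    -- The given `K` need not be compared with `K₀`: its representing property, applied to `z`,
    -- already turns `⟨G z, z⟩` into the double integral.
    filter_upwards [hzL, hK.2 _ _ (hG (hz.toLp z))] with x hx hx'
    have e : ∫ ξ in P.U, K x ξ * hz.toLp z ξ = ∫ ξ in P.U, K x ξ * z ξ := by
      refine integral_congr_ae ?_
      filter_upwards [hzL] with ξ hξ
      rw [hξ]
    rw [hx, hx', e]
    simp only [RCLike.inner_apply, conj_trivial]
    rw [← integral_const_mul]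
    simp only [mul_assoc]
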